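/- For every integer $d\ge 1$ there is a constant $b_d>0$, depending only on $d$, such that the following holds for every field $\mathbb F$, every finite $d$-dimensional abstract simplicial complex $K$ with linearly ordered vertices, and every integer $k\ge 0$. Orient each face of $K$ by the vertex order, and for a $d$-face $\sigma=[v_0,\dots,v_d]$ with $v_0<\dots<v_d$ let $\partial\sigma=\sum_{j=0}^d(-1)^j[v_0,\dots,\widehat{v_j},\dots,v_d]$. A $d$-cycle of $K$ is an $\mathbb F$-linear combination $C=\sum_{i=1}^m\alpha_i\sigma_i$ of distinct $d$-faces of $K$ with all $\alpha_i\ne0$ and $\sum_i\alpha_i\,\partial\sigma_i=0$; its size is $m$, and it is nontrivial if $m>0$. A nontrivial $d$-cycle is called simple if for each $i$ the boundaries $\partial\sigma_j$, $j\neq i$, are linearly independent over $\mathbb F$. Let $f_d(K)$ be the number of $d$-faces of $K$, and let $\operatorname{rank}_d(K)$ be the dimension over $\mathbb F$ of the span of $\{\partial\sigma : \sigma \text{ a } d\text{-face of } K\}$. If $K$ has a nontrivial $d$-cycle over $\mathbb F$ and $$f_d(K)\;>\;b_d\cdot k^{\,2+2/d}\cdot \operatorname{rank}_d(K),$$ then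 $K$ contains a simple $d$-cycle of size greater than $k$. -/

import Mathlib

noncomputable section

namespace SimplicialCycle

/-- `K^{(i)}`: the set of `i`-dimensional faces of `K`, that is, the faces with `i + 1` vertices.
A face stands for the simplex `[v₀, …, vᵢ]` oriented by `v₀ < ⋯ < vᵢ`. -/
def simplices {V : Type*} (K : PreAbstractSimplicialComplex V) (i : ℕ) : Set (Finset V) :=
  {σ | σ ∈ K ∧ σ.card = i + 1}

/-- `f_i(K)`: the number of `i`-dimensional faces of `K`. -/
def faceCount {V : Type*} (K : PreAbstractSimplicialComplex V) (i : ℕ) : ℕ :=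
  (simplices K i).ncard

/-- `K` is `d`-dimensional: the largest dimension of a face of `K` is `d`. -/
def HasDimension {V : Type*} (K : PreAbstractSimplicialComplex V) (d : ℕ) : Prop :=
  (simplices K d).Nonempty ∧ ∀ σ ∈ K, σ.card ≤ d + 1

/-- `C_i(K; F)`: the `i`-chains of `K`, inside the space of all formal `F`-linear
combinations of finite subsets of `V`. -/
def chains (F : Type*) [Field F] {V : Type*} (K : PreAbstractSimplicialComplex V) (i : ℕ) :
    Submodule F (Finset V →₀ F) :=
  Finsupp.supported F F (simplices K i)

/-- The boundary `∂σ = ∑ⱼ (-1)ʲ [v₀, …, ṽⱼ, …, vᵢ]` of `σ = [v₀, …, vᵢ]`, `v₀ < ⋯ < vᵢ`.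
The position `j` of a vertex `v` of `σ` is the number of vertices of `σ` that are less than `v`. -/
def simplexBoundary (F : Type*) [Field F] {V : Type*} [LinearOrder V] (σ : Finset V) :
    Finset V →₀ F :=
  ∑ v ∈ σ, Finsupp.single (σ.erase v) ((-1 : F) ^ (σ.filter (fun w => w < v)).card)

/-- The linear extension of the boundary to chains. In every dimension `i ≥ 1` its restriction
to `C_i(K; F)` is the boundary map `∂_i : C_i(K; F) → C_{i-1}(K; F)`. -/
def boundary (F : Type*) [Field F] (V : Type*) [LinearOrder V] :
    (Finset V →₀ F) →ₗ[F] (Finset V →₀ F) :=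
  Finsupp.linearCombination F (simplexBoundary F)

/-- `Z_d(K; F)`: the `d`-cycles of `K` over `F` (for `d ≥ 1`). -/
def cycles (F : Type*) [Field F] {V : Type*} [LinearOrder V]
    (K : PreAbstractSimplicialComplex V) (d : ℕ) : Submodule F (Finset V →₀ F) :=
  chains F K d ⊓ LinearMap.ker (boundary F V)

/-- A simple `d`-cycle of `K`: a nontrivial `d`-cycle `C = ∑ᵢ αᵢ σᵢ` (all `αᵢ ≠ 0`) such that for
each `i` the boundaries of the simplices `σⱼ`, `j ≠ i`, are linearly independent. -/
def IsSimpleCycle (F : Type*) [Field F] {V : Type*} [LinearOrder V]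
    (K : PreAbstractSimplicialComplex V) (d : ℕ) (C : Finset V →₀ F) : Prop :=
  C ∈ cycles F K d ∧ C ≠ 0 ∧
    ∀ σ ∈ C.support, LinearIndepOn F (simplexBoundary F) ((C.support : Set (Finset V)) \ {σ})

/-- The rank of a family `A` of simplices: the linear-algebraic rank of `{∂σ | σ ∈ A}`. -/
def familyRank (F : Type*) [Field F] {V : Type*} [LinearOrder V] (A : Set (Finset V)) : ℕ :=
  Module.finrank F (Submodule.span F (simplexBoundary F '' A))

/-- `rank_d(K)`: the rank of the family of all `d`-simplices of `K`. -/
def complexRank (F : Type*) [Field F] {V : Type*} [LinearOrder V]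
    (K : PreAbstractSimplicialComplex V) (d : ℕ) : ℕ :=
  familyRank F (simplices K d)

end SimplicialCycle

end

/-! Simple `d`-cycles are the circuits of the matroid on the `d`-faces represented by their
boundaries. Suppose that every circuit has at most `k` elements. Then `exists_cover` covers the
faces by at most `rank_d(K)` sets of rank at most `k ^ 2 + 1`. A family of rank `r` has a shadow of
size at most `(d + 1) * r`, so by Kruskal–Katona each set has `O(k ^ (2 + 2 / d))` faces; summing
bounds `f_d(K)`.

The cover is built by induction. Connected components are treated separately; in a connected matroid
a longest circuit `c` is contracted. All circuits of the contraction are shorter than `c`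
(`card_support_lt_of_contract`), so the circuit bound drops while undoing the contraction raises
each rank by at most `|c|`. The loops of the contraction form with `c` one more set, paid for by the
drop in total rank.

The hard case of the shortness claim is a circuit `x` of the contraction that is already a circuit
before it. If `|x| ≥ |c|`, then `exists_isElementary_of_disjoint` produces a circuit longer than
`c`. -/

namespace SimplicialCycle

/-! ### Circuits as relations of minimal support. -/

section Relations

variable {E F : Type*} [Field F]

/-- A nonzero vector of `R` of minimal support: a circuit of the matroid with relation space `R`. -/
def IsElementary (R : Submodule F (E →₀ F)) (x : E →₀ F) : Prop :=
  x ∈ R ∧ x ≠ 0 ∧ ∀ w ∈ R, (∀ e, x e = 0 → w e = 0) → ∃ a : F, w = a • x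

/-- If `w` has its support inside that of `x` and `w p ≠ 0`, then subtracting a multiple of `w`
from `x` to remove `p` from the support yields a strictly smaller support. -/
theorem card_support_sub_lt {x w : E →₀ F} (hw : ∀ e, x e = 0 → w e = 0) {p : E}
    (hp : w p ≠ 0) : (x - (x p / w p) • w).support.card < x.support.card := by
  apply Finset.card_lt_card
  refine Finset.ssubset_iff_subset_ne.2 ⟨fun e he => ?_, fun h => ?_⟩
  · rw [Finsupp.mem_support_iff] at he ⊢
    intro h0
    exact he (by simp [h0, hw e h0])
  · have : p ∈ x.support := Finsupp.mem_support_iff.2 fun h0 => hp (hw p h0)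
    rw [← h, Finsupp.mem_support_iff] at this
    exact this (by simp [hp])

/-- If `x` is not elementary, some relation on its support is not a multiple of it. Corrected to
vanish at `e`, that relation cancels another coordinate of `x` and leaves `x e` alone. -/
theorem exists_isElementary {R : Submodule F (E →₀ F)} {x : E →₀ F} (hx : x ∈ R) {e : E}
    (he : x e ≠ 0) : ∃ z, IsElementary R z ∧ (∀ f, x f = 0 → z f = 0) ∧ z e ≠ 0 := by
  induction hn : x.support.card using Nat.strong_induction_on generalizing x with
  | _ n ih =>
    subst hn
    by_cases hel : IsElementary R x
    · exact ⟨x, hel, fun _ h => h, he⟩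
    have : ∃ w ∈ R, (∀ f, x f = 0 → w f = 0) ∧ ∀ a : F, w ≠ a • x := by
      by_contra! hcon
      exact hel ⟨hx, fun h => he (by simp [h]), fun w hw h => hcon w hw h⟩
    obtain ⟨w, hw, hwx, hwa⟩ := this
    set w' := w - (w e / x e) • x with hw'
    have hw'R : w' ∈ R := R.sub_mem hw (R.smul_mem _ hx)
    have hw'x : ∀ f, x f = 0 → w' f = 0 := fun f hf => by simp [hw', hf, hwx f hf]
    have hw'e : w' e = 0 := by simp [hw', he]
    have hw'0 : w' ≠ 0 := fun h => hwa _ (sub_eq_zero.1 h)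
    obtain ⟨p, hp⟩ := Finsupp.ne_iff.1 hw'0
    obtain ⟨z, hz, hzx, hze⟩ := ih _ (card_support_sub_lt hw'x hp)
      (R.sub_mem hx (R.smul_mem _ hw'R)) (by simpa [hw'e] using he) rfl
    exact ⟨z, hz, fun f hf => hzx f (by simp [hf, hw'x f hf]), hze⟩

/-- Induction over relations through their decomposition into elementary ones. -/
theorem isElementary_induction {R : Submodule F (E →₀ F)} (S : Submodule F (E →₀ F))
    (h : ∀ z, IsElementary R z → z ∈ S) {x : E →₀ F} (hx : x ∈ R) : x ∈ S := by
  induction hn : x.support.card using Nat.strong_induction_on generalizing x with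
  | _ n ih =>
    subst hn
    by_cases hx0 : x = 0
    · rw [hx0]; exact S.zero_mem
    obtain ⟨p, hp⟩ := Finsupp.ne_iff.1 hx0
    obtain ⟨z, hz, hzx, hze⟩ := exists_isElementary hx hp
    have := ih _ (card_support_sub_lt hzx hze) (R.sub_mem hx (R.smul_mem _ hz.1)) rfl
    simpa using S.add_mem this (S.smul_mem (x p / z p) (h z hz))

/-- If an elementary relation through `e` meets one through `f`, then some elementary relation
passes through both `e` and `f`. -/
theorem IsElementary.exists_through {R : Submodule F (E →₀ F)} {x y : E →₀ F}
    (hx : IsElementary R x) (hy : IsElementary R y) {e f g : E} (he : x e ≠ 0) (hf : y f ≠ 0)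
    (hgx : x g ≠ 0) (hgy : y g ≠ 0) : ∃ z, IsElementary R z ∧ z e ≠ 0 ∧ z f ≠ 0 := by
  classical
  induction hn : (x.support ∪ y.support).card using Nat.strong_induction_on
    generalizing x y g with
  | _ n ih =>
    subst hn
    by_cases hye : y e = 0
    swap
    · exact ⟨y, hy, hye, hf⟩
    by_cases hxf : x f = 0
    swap
    · exact ⟨x, hx, he, hxf⟩
    -- Eliminating `g` keeps both `e` and `f`, because `y e = 0` and `x f = 0`.
    set s := x - (x g / y g) • y with hs
    have hsR : s ∈ R := R.sub_mem hx.1 (R.smul_mem _ hy.1)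
    have hsg : s g = 0 := by simp [hs, hgy]
    have hse : s e ≠ 0 := by simpa [hs, hye] using he
    have hsf : s f ≠ 0 := by simp [hs, hxf, hgx, hgy, hf]
    have hs0 : ∀ i, x i = 0 → y i = 0 → s i = 0 := fun i h1 h2 => by simp [hs, h1, h2]
    obtain ⟨z, hz, hzs, hze⟩ := exists_isElementary hsR hse
    obtain ⟨t, ht, hts, htf⟩ := exists_isElementary hsR hsf
    -- each of the two new relations leaves the support of the relation it replaces
    have key : ∀ {x y z : E →₀ F}, IsElementary R x → (∀ i, x i = 0 → y i = 0 → z i = 0) →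
        z ∈ R → z g = 0 → x g ≠ 0 → z ≠ 0 → ∃ h, z h ≠ 0 ∧ y h ≠ 0 ∧ x h = 0 := by
      intro x y z hx h0 hzR hzg hxg hz0
      by_contra! hcon
      obtain ⟨a, rfl⟩ := hx.2.2 z hzR fun i hi => by
        by_contra hzi
        exact hcon i hzi (fun hyi => hzi (h0 i hi hyi)) hi
      have : a = 0 := by simpa [hxg] using hzg
      exact hz0 (by simp [this])
    obtain ⟨h, hzh, hyh, -⟩ := key (z := z) hx (fun i h1 h2 => hzs i (hs0 i h1 h2)) hz.1
      (hzs g hsg) hgx hz.2.1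
    obtain ⟨h', hth', hxh', hyh'⟩ := key (z := t) hy (fun i h1 h2 => hts i (hs0 i h2 h1)) ht.1
      (hts g hsg) hgy ht.2.1
    have hlt : ∀ u v : E →₀ F, (∀ i, x i = 0 → y i = 0 → u i = 0) →
        (∀ i, x i = 0 → y i = 0 → v i = 0) → (∃ i, (x i ≠ 0 ∨ y i ≠ 0) ∧ u i = 0 ∧ v i = 0) →
        (u.support ∪ v.support).card < (x.support ∪ y.support).card := by
      rintro u v hu hv ⟨i, hi, hui, hvi⟩
      apply Finset.card_lt_card
      refine Finset.ssubset_iff_of_subset ?_ |>.2 ⟨i, by simpa using hi, by simp [hui, hvi]⟩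
      intro j hj
      by_contra hcon
      simp only [Finset.mem_union, Finsupp.mem_support_iff, not_or, not_not] at hcon hj
      rcases hj with hj | hj
      · exact hj (hu j hcon.1 hcon.2)
      · exact hj (hv j hcon.1 hcon.2)
    have hz0 : ∀ i, x i = 0 → y i = 0 → z i = 0 := fun i h1 h2 => hzs i (hs0 i h1 h2)
    have ht0 : ∀ i, x i = 0 → y i = 0 → t i = 0 := fun i h1 h2 => hts i (hs0 i h1 h2)
    -- Either `z` and `y` together miss an element, and their union is smaller; or `z` contains all
    -- of `x` outside `y`, so it meets `t` at `h'`, and `z`, `t` both miss `g`.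
    by_cases hc : ∃ i, (x i ≠ 0 ∨ y i ≠ 0) ∧ z i = 0 ∧ y i = 0
    · exact ih _ (hlt z y hz0 (fun _ _ h => h) hc) hz hy hze hf hzh hyh rfl
    · have hzh' : z h' ≠ 0 := fun h0 => hc ⟨h', Or.inl hxh', h0, hyh'⟩
      exact ih _ (hlt z t hz0 ht0 ⟨g, Or.inl hgx, hzs g hsg, hts g hsg⟩) hz ht hze htf hzh' hth' rfl

/-- If `z` is not proportional to `c` on the support of `c`, then a multiple of `c` can be
subtracted from `z` so that at least one and at most half of these coordinates vanish. -/
theorem exists_half [DecidableEq F] {z c : E →₀ F} (h : ¬ ∃ s, ∀ e, c e ≠ 0 → z e = s * c e) :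
    ∃ s, (∃ e, c e ≠ 0 ∧ z e = s * c e) ∧
      c.support.card ≤ 2 * (c.support.filter fun e => z e ≠ s * c e).card := by
  classical
  push Not at h
  -- Two distinct ratios `z / c` occur. Every coordinate differs from at least one of them, so one
  -- of the two differs from the ratio on at least half of the coordinates.
  obtain ⟨e, hce, -⟩ := h 0
  obtain ⟨f, hcf, hf⟩ := h (z e / c e)
  have h1 : z e = z e / c e * c e := by field_simp
  have h2 : z f = z f / c f * c f := by field_simp
  have hne : z e / c e ≠ z f / c f := fun h => hf (by rw [h]; exact h2)
  have hun : c.support = (c.support.filter fun i => z i ≠ z e / c e * c i) ∪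
      (c.support.filter fun i => z i ≠ z f / c f * c i) := by
    rw [← Finset.filter_or, Finset.filter_true_of_mem]
    intro i hi
    by_contra! hcon
    exact hne (mul_right_cancel₀ (Finsupp.mem_support_iff.1 hi) (hcon.1.symm.trans hcon.2))
  have hle := (congrArg Finset.card hun).le.trans (Finset.card_union_le _ _)
  by_cases hcard : (c.support.filter fun i => z i ≠ z e / c e * c i).card ≤
      (c.support.filter fun i => z i ≠ z f / c f * c i).card
  · exact ⟨_, ⟨f, hcf, h2⟩, by omega⟩
  · exact ⟨_, ⟨e, hce, h1⟩, by omega⟩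

open Finsupp in
/-- Two disjoint elementary relations `c`, `d` that are skew but lie in one connected component
give rise to an elementary relation covering half of each, and one more element. -/
theorem exists_isElementary_of_disjoint {R : Submodule F (E →₀ F)} {c d w : E →₀ F}
    (hc : c ∈ R) (hd : d ∈ R) (hcd : ∀ e, c e ≠ 0 → d e = 0)
    (hskew : ∀ y ∈ R, (∀ e, c e = 0 → d e = 0 → y e = 0) → ∃ a b : F, y = a • c + b • d)
    (hw : IsElementary R w) {e f : E} (hce : c e ≠ 0) (hwe : w e ≠ 0) (hdf : d f ≠ 0)
    (hwf : w f ≠ 0) :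
    ∃ z, IsElementary R z ∧ c.support.card + d.support.card + 2 ≤ 2 * z.support.card := by
  classical
  have hdc : ∀ e, d e ≠ 0 → c e = 0 := fun e h => by_contra fun h' => h (hcd e h')
  -- Relations on `P` and the supports of `c` and `d` that avoid `c` (for `A P`) or avoid `d` (for
  -- `B P`). `Bad P` says that some relation there does not split into two such parts.
  let A : Finset E → Submodule F (E →₀ F) := fun P =>
    R ⊓ supported F F {e | c e = 0 ∧ (d e ≠ 0 ∨ e ∈ P)}
  let B : Finset E → Submodule F (E →₀ F) := fun P =>
    R ⊓ supported F F {e | d e = 0 ∧ (c e ≠ 0 ∨ e ∈ P)}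
  let Bad : Finset E → Prop := fun P =>
    ∃ y ∈ R, (∀ e ∉ P, c e = 0 → d e = 0 → y e = 0) ∧ y ∉ A P ⊔ B P
  have hmono : ∀ {P Q : Finset E}, P ⊆ Q → A P ⊔ B P ≤ A Q ⊔ B Q := by
    intro P Q h
    refine sup_le_sup (inf_le_inf_left _ (supported_mono ?_))
      (inf_le_inf_left _ (supported_mono ?_))
    · exact fun i hi => ⟨hi.1, hi.2.imp id fun h' => h h'⟩
    · exact fun i hi => ⟨hi.1, hi.2.imp id fun h' => h h'⟩
  have hcB : ∀ P, c ∈ A P ⊔ B P := fun P => Submodule.mem_sup_right ⟨hc,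
    (mem_supported' _ _).2 fun i hi => by_contra fun h => hi ⟨hcd i h, Or.inl h⟩⟩
  have hdA : ∀ P, d ∈ A P ⊔ B P := fun P => Submodule.mem_sup_left ⟨hd,
    (mem_supported' _ _).2 fun i hi => by_contra fun h => hi ⟨hdc i h, Or.inl h⟩⟩
  -- In a splitting `w = u + v`, the part `u` lies in the support of `w`, so it is a multiple of
  -- `w`. It vanishes at `e`, hence is zero, and then `w = v` vanishes at `f`.
  have hbad : Bad w.support := by
    refine ⟨w, hw.1, fun i hi _ _ => by simpa using hi, fun hmem => ?_⟩
    obtain ⟨u, ⟨huR, hu⟩, v, ⟨hvR, hv⟩, huv⟩ := Submodule.mem_sup.1 hmem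
    have hu := (mem_supported' _ _).1 hu
    have hv := (mem_supported' _ _).1 hv
    obtain ⟨a, rfl⟩ := hw.2.2 u huR fun i hi => by
      by_cases hdi : d i = 0
      · exact hu i fun h => by simpa [hdi, hi] using h.2
      · have h1 := hv i fun h => hdi h.1
        have h2 : u i + v i = w i := by rw [← huv]; rfl
        rw [← hi, ← h2, h1, add_zero]
    have ha : a = 0 := by
      have := hu e fun h => hce h.1
      simpa [hwe] using this
    have hvf := hv f fun h => hdf h.1
    apply hwf
    rw [← huv]
    simp [ha, hvf]
  have hmin : ∃ P, Bad P ∧ ∀ Q, Q ⊂ P → ¬ Bad Q := by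
    obtain ⟨P, hP, hPm⟩ := WellFounded.has_min (wellFounded_lt (α := Finset E)) {P | Bad P}
      ⟨_, hbad⟩
    exact ⟨P, hP, fun Q hQ hb => hPm Q hb hQ⟩
  obtain ⟨P, ⟨y, hyR, hyP, hyT⟩, hPmin⟩ := hmin
  have hyc : ¬ ∃ s, ∀ e, c e ≠ 0 → y e = s * c e := by
    rintro ⟨s, hs⟩
    have h1 : y - s • c ∈ A P := ⟨R.sub_mem hyR (R.smul_mem _ hc), (mem_supported' _ _).2
      fun i hi => by
        by_cases hci : c i = 0
        · by_cases hdi : d i = 0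
          · simp [hyP i (fun h => hi ⟨hci, Or.inr h⟩) hci hdi, hci]
          · exact absurd ⟨hci, Or.inl hdi⟩ hi
        · simp [hs i hci]⟩
    exact hyT (by simpa using add_mem (Submodule.mem_sup_left h1) ((A P ⊔ B P).smul_mem s (hcB P)))
  have hyd : ¬ ∃ s, ∀ e, d e ≠ 0 → y e = s * d e := by
    rintro ⟨s, hs⟩
    have h1 : y - s • d ∈ B P := ⟨R.sub_mem hyR (R.smul_mem _ hd), (mem_supported' _ _).2
      fun i hi => by
        by_cases hdi : d i = 0
        · by_cases hci : c i = 0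
          · simp [hyP i (fun h => hi ⟨hdi, Or.inr h⟩) hci hdi, hdi]
          · exact absurd ⟨hdi, Or.inl hci⟩ hi
        · simp [hs i hdi]⟩
    exact hyT (by simpa using add_mem (Submodule.mem_sup_right h1) ((A P ⊔ B P).smul_mem s (hdA P)))
  obtain ⟨s, ⟨e₀, hce₀, hye₀⟩, hs⟩ := exists_half hyc
  obtain ⟨t, ⟨f₀, hdf₀, hyf₀⟩, ht⟩ := exists_half hyd
  -- Still unsplittable, `z` keeps at least half of each support and misses `e₀` and `f₀`. It is the
  -- required circuit.
  set z := y - (s • c + t • d) with hz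
  have hzR : z ∈ R :=
    R.sub_mem hyR (R.add_mem (R.smul_mem _ hc) (R.smul_mem _ hd))
  have hzT : z ∉ A P ⊔ B P := fun h => hyT (by
    simpa [hz] using add_mem h
      (add_mem ((A P ⊔ B P).smul_mem s (hcB P)) ((A P ⊔ B P).smul_mem t (hdA P))))
  have hzP : ∀ e ∉ P, c e = 0 → d e = 0 → z e = 0 := fun i hi h1 h2 => by
    simp [hz, h1, h2, hyP i hi h1 h2]
  have hze₀ : z e₀ = 0 := by simp [hz, hye₀, hcd e₀ hce₀]
  have hzf₀ : z f₀ = 0 := by simp [hz, hyf₀, hdc f₀ hdf₀]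
  obtain ⟨p, hcp, hdp, hzp⟩ : ∃ p, c p = 0 ∧ d p = 0 ∧ z p ≠ 0 := by
    by_contra! hcon
    obtain ⟨a, b, hab⟩ := hskew z hzR hcon
    exact hzT (hab ▸ add_mem ((A P ⊔ B P).smul_mem a (hcB P)) ((A P ⊔ B P).smul_mem b (hdA P)))
  -- A relation inside `z` that misses an outer element `p` of `z` lives on `P.erase p`, so it
  -- splits by minimality of `P`.
  have hsplit : ∀ w' ∈ R, (∀ i, z i = 0 → w' i = 0) → ∀ p, c p = 0 → d p = 0 → z p ≠ 0 →
      w' p = 0 → w' ∈ A P ⊔ B P := by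
    intro w' hw' hw'z p hcp hdp hzp hw'p
    have hpP : p ∈ P := by_contra fun h => hzp (hzP p h hcp hdp)
    by_contra hcon
    refine hPmin (P.erase p) (Finset.erase_ssubset hpP) ⟨w', hw', fun i hi h1 h2 => ?_,
      fun h => hcon (hmono (Finset.erase_subset _ _) h)⟩
    by_cases hip : i = p
    · rw [hip, hw'p]
    · exact hw'z i (hzP i (fun h => hi (Finset.mem_erase.2 ⟨hip, h⟩)) h1 h2)
  -- If `w'` had an outer element `i`, cancelling `i` in `z` would leave a splitting relation, so
  -- `z` would split. Hence `w'` is a combination of `c` and `d`, killed by the zeros of `z` at `e₀`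
  -- and `f₀`.
  have helem : ∀ w' ∈ R, (∀ i, z i = 0 → w' i = 0) → w' p = 0 → w' = 0 := by
    intro w' hw' hw'z hw'p
    have hw'T := hsplit w' hw' hw'z p hcp hdp hzp hw'p
    have hoff : ∀ i, c i = 0 → d i = 0 → w' i = 0 := by
      intro i hci hdi
      by_contra hw'i
      have hzi : z i ≠ 0 := fun h => hw'i (hw'z i h)
      have := hsplit (z - (z i / w' i) • w') (R.sub_mem hzR (R.smul_mem _ hw'))
        (fun j hj => by simp [hj, hw'z j hj]) i hci hdi hzi (by simp [hw'i])
      exact hzT (by simpa using add_mem this ((A P ⊔ B P).smul_mem (z i / w' i) hw'T))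
    obtain ⟨a, b, rfl⟩ := hskew w' hw' hoff
    have ha : a = 0 := by simpa [hcd e₀ hce₀, hce₀] using hw'z e₀ hze₀
    have hb : b = 0 := by simpa [hdc f₀ hdf₀, hdf₀] using hw'z f₀ hzf₀
    simp [ha, hb]
  refine ⟨z, ⟨hzR, fun h => hzp (by simp [h]), fun w' hw' hw'z => ⟨w' p / z p, ?_⟩⟩, ?_⟩
  · exact sub_eq_zero.1 (helem _ (R.sub_mem hw' (R.smul_mem _ hzR))
      (fun i hi => by simp [hi, hw'z i hi]) (by simp [hzp]))
  · set C := c.support.filter fun e => y e ≠ s * c e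
    set D := d.support.filter fun e => y e ≠ t * d e
    have hCD : Disjoint C D := by
      rw [Finset.disjoint_left]
      intro i hi hi'
      simp only [C, D, Finset.mem_filter, mem_support_iff] at hi hi'
      exact hi'.1 (hcd i hi.1)
    have hp' : p ∉ C ∪ D := by simp [C, D, hcp, hdp]
    have hsub : insert p (C ∪ D) ⊆ z.support := by
      intro i hi
      simp only [C, D, Finset.mem_insert, Finset.mem_union, Finset.mem_filter,
        mem_support_iff] at hi ⊢
      rcases hi with rfl | ⟨h1, h2⟩ | ⟨h1, h2⟩
      · exact hzp
      · simpa [hz, hcd i h1, sub_eq_zero] using h2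
      · simpa [hz, hdc i h1, sub_eq_zero] using h2
    have := Finset.card_le_card hsub
    rw [Finset.card_insert_of_notMem hp', Finset.card_union_of_disjoint hCD] at this
    omega

/-- Contracting a longest circuit `c` of a connected matroid leaves only shorter circuits. Here
`x` is a circuit of the contraction, and `y` a relation that extends it. -/
theorem card_support_lt_of_contract {R : Submodule F (E →₀ F)} {c x y : E →₀ F}
    (hc : IsElementary R c) (hmax : ∀ z, IsElementary R z → z.support.card ≤ c.support.card)
    (hxc : ∀ e, c e ≠ 0 → x e = 0) (hx0 : x ≠ 0) (hy : y ∈ R) (hyx : ∀ e, c e = 0 → y e = x e)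
    (hmin : ∀ w ∈ R, (∀ e, c e = 0 → x e = 0 → w e = 0) → ∃ a : F, ∀ e, c e = 0 → w e = a * x e)
    (hconn : ∀ e f, c e ≠ 0 → x f ≠ 0 → ∃ z, IsElementary R z ∧ z e ≠ 0 ∧ z f ≠ 0) :
    x.support.card < c.support.card := by
  classical
  obtain ⟨f, hf⟩ := Finsupp.ne_iff.1 hx0
  obtain ⟨e, he⟩ := Finsupp.ne_iff.1 hc.2.1
  have hf : x f ≠ 0 := hf
  have he : c e ≠ 0 := he
  have hcf : c f = 0 := by_contra fun h => hf (hxc f h)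
  -- If proportional, `x` is itself a relation, skew to `c`, and a circuit covering more than half
  -- of both exists. Otherwise `y` can be shifted to miss `e` but not `g`, giving a circuit strictly
  -- larger than `x`.
  by_cases hprop : ∃ s, ∀ e, c e ≠ 0 → y e = s * c e
  · obtain ⟨s, hs⟩ := hprop
    have hxy : x = y - s • c := by
      ext i
      by_cases hi : c i = 0
      · simp [hi, hyx i hi]
      · simp [hxc i hi, hs i hi]
    have hxR : x ∈ R := hxy ▸ R.sub_mem hy (R.smul_mem _ hc.1)
    obtain ⟨w, hw, hwe, hwf⟩ := hconn e f he hf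
    obtain ⟨z, hz, hcard⟩ := exists_isElementary_of_disjoint hc.1 hxR hxc
      (fun u hu hu0 => by
        obtain ⟨a, ha⟩ := hmin u hu hu0
        obtain ⟨b, hb⟩ := hc.2.2 (u - a • x) (R.sub_mem hu (R.smul_mem _ hxR))
          fun i hi => by simp [ha i hi]
        exact ⟨b, a, by rw [← hb]; simp⟩) hw he hwe hf hwf
    have := hmax z hz
    omega
  · push Not at hprop
    obtain ⟨g, hg, hyg⟩ := hprop (y e / c e)
    set z := y - (y e / c e) • c with hz
    have hzR : z ∈ R := R.sub_mem hy (R.smul_mem _ hc.1)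
    have hze : z e = 0 := by simp [hz, he]
    have hzx : ∀ i, c i = 0 → z i = x i := fun i hi => by simp [hz, hi, hyx i hi]
    have hel : IsElementary R z := by
      refine ⟨hzR, fun h => hf ?_, fun w hw hwz => ?_⟩
      · rw [← hzx f hcf, h]; rfl
      · obtain ⟨a, ha⟩ := hmin w hw fun i h1 h2 => hwz i (by rw [hzx i h1, h2])
        obtain ⟨b, hb⟩ := hc.2.2 (w - a • z) (R.sub_mem hw (R.smul_mem _ hzR))
          fun i hi => by simp [ha i hi, hzx i hi]
        have hbe : b * c e = 0 := by
          have := DFunLike.congr_fun hb e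
          simpa [hze, hwz e hze] using this.symm
        have hb0 : b = 0 := by simpa [he] using hbe
        exact ⟨a, sub_eq_zero.1 (by rw [hb, hb0, zero_smul])⟩
    refine lt_of_lt_of_le (Finset.card_lt_card ?_) (hmax z hel)
    refine (Finset.ssubset_iff_of_subset fun i hi => ?_).2 ⟨g, ?_, ?_⟩
    · rw [Finsupp.mem_support_iff] at hi ⊢
      rwa [hzx i (by_contra fun h => hi (hxc i h))]
    · rw [Finsupp.mem_support_iff]
      simpa [hz, sub_eq_zero] using hyg
    · simp [hxc g hg]

end Relations

/-! ### Covering a matroid with short circuits by sets of small rank. -/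

section Cover

open Module Submodule Finsupp

variable {E F : Type*} [Field F]

/-- The linear relations among the vectors `v e`, `e ∈ A`. -/
noncomputable def relations (F : Type*) [Field F] {W : Type*} [AddCommGroup W] [Module F W] (v : E → W) (A : Finset E) :
    Submodule F (E →₀ F) :=
  LinearMap.ker (linearCombination F v) ⊓ supported F F (A : Set E)

theorem mem_relations {W : Type*} [AddCommGroup W] [Module F W] {v : E → W} {A : Finset E}
    {x : E →₀ F} :
    x ∈ relations F v A ↔ linearCombination F v x = 0 ∧ ∀ e ∉ A, x e = 0 := by
  simp [relations, mem_supported']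

theorem finrank_map_mkQ_add {W : Type*} [AddCommGroup W] [Module F W] (U S : Submodule F W)
    [FiniteDimensional F S] :
    finrank F (S.map U.mkQ) + finrank F (S ⊓ U : Submodule F W) = finrank F S := by
  have h := LinearMap.finrank_range_add_finrank_ker (U.mkQ.domRestrict S)
  rw [LinearMap.range_domRestrict, LinearMap.ker_domRestrict, ker_mkQ] at h
  rwa [← (comap_equiv_self_of_inj_of_le S.injective_subtype (p := S ⊓ U)
    (by simp)).finrank_eq, comap_inf, comap_subtype_self, top_inf_eq]

theorem span_mkQ_image {W : Type*} [AddCommGroup W] [Module F W] (U : Submodule F W) (v : E → W)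
    (A : Set E) : span F ((fun e => U.mkQ (v e)) '' A) = (span F (v '' A)).map U.mkQ := by
  rw [map_span, Set.image_image]

theorem finrank_span_image_le {W : Type*} [AddCommGroup W] [Module F W] (v : E → W)
    (A : Finset E) : finrank F (span F (v '' A)) ≤ A.card := by
  classical
  rw [← Finset.coe_image]
  exact (finrank_span_finset_le_card _).trans Finset.card_image_le

instance finiteDimensional_span_image {W : Type*} [AddCommGroup W] [Module F W] (v : E → W)
    (A : Finset E) : FiniteDimensional F (span F (v '' A)) :=
  FiniteDimensional.span_of_finite F (A.finite_toSet.image v)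

theorem finrank_span_image_le_contract {W : Type*} [AddCommGroup W] [Module F W] (v : E → W)
    (C A : Finset E) : finrank F (span F (v '' A)) ≤
      finrank F (span F ((fun e => (span F (v '' C)).mkQ (v e)) '' A)) + C.card := by
  rw [span_mkQ_image, ← finrank_map_mkQ_add (span F (v '' C)) (span F (v '' A))]
  exact Nat.add_le_add_left
    ((finrank_mono inf_le_right).trans (finrank_span_image_le v C)) _

theorem finrank_contract_add_le {W : Type*} [AddCommGroup W] [Module F W] (v : E → W)
    {B C A : Finset E} (hC : C ⊆ A) (hB : B ⊆ A) :
    finrank F (span F ((fun e => (span F (v '' C)).mkQ (v e)) '' B)) +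
      finrank F (span F (v '' C)) ≤ finrank F (span F (v '' A)) := by
  have hCA : span F (v '' C) ≤ span F (v '' A) := span_mono (Set.image_mono (by simpa using hC))
  have hBA : span F (v '' B) ≤ span F (v '' A) := span_mono (Set.image_mono (by simpa using hB))
  rw [span_mkQ_image, ← finrank_map_mkQ_add (span F (v '' C)) (span F (v '' A)),
    inf_eq_right.2 hCA]
  have : FiniteDimensional F ((span F (v '' A)).map (span F (v '' C)).mkQ) := inferInstance
  exact Nat.add_le_add_right (finrank_mono (map_mono hBA)) _

/-- If every circuit lies on one side of a partition, then the ranks of the sides add up. -/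
theorem finrank_add_finrank_le_of_separation {W : Type*} [AddCommGroup W] [Module F W]
    (v : E → W) {A A₁ A₂ : Finset E} (h₁ : A₁ ⊆ A) (h₂ : A₂ ⊆ A) (hdisj : Disjoint A₁ A₂)
    (h : ∀ z, IsElementary (relations F v A) z →
      (∀ e ∈ A₁, z e = 0) ∨ (∀ e ∉ A₁, z e = 0)) :
    finrank F (span F (v '' A₁)) + finrank F (span F (v '' A₂)) ≤ finrank F (span F (v '' A)) := by
  have hle : span F (v '' A₁) ⊔ span F (v '' A₂) ≤ span F (v '' A) :=
    sup_le (span_mono (Set.image_mono (by simpa using h₁)))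
      (span_mono (Set.image_mono (by simpa using h₂)))
  have hbot : span F (v '' A₁) ⊓ span F (v '' A₂) = ⊥ := by
    rw [eq_bot_iff]
    rintro u ⟨hu₁, hu₂⟩
    obtain ⟨x, hx, rfl⟩ := (mem_span_image_iff_linearCombination F).1 hu₁
    obtain ⟨y, hy, hxy⟩ := (mem_span_image_iff_linearCombination F).1 hu₂
    rw [mem_supported'] at hx hy
    have hmem : x - y ∈ relations F v A := by
      refine mem_relations.2 ⟨by rw [map_sub, hxy, sub_self], fun e he => ?_⟩
      simp [hx e (fun h => he (h₁ h)), hy e (fun h => he (h₂ h))]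
    classical
    -- `S` consists of the vectors whose restriction to `A₁` is a relation. It contains all
    -- elementary relations, hence `x - y`, whose restriction is `x`.
    let S : Submodule F (E →₀ F) :=
      (LinearMap.ker (linearCombination F v)).comap
        ((supported F F (A₁ : Set E)).subtype ∘ₗ restrictDom F F (A₁ : Set E))
    have hS : x - y ∈ S := isElementary_induction S (fun z hz => ?_) hmem
    · have : filter (· ∈ (A₁ : Set E)) (x - y) = x := by
        ext e
        by_cases he : e ∈ A₁
        · simp [he, hy e (fun h => Finset.disjoint_left.1 hdisj he h)]
        · simp [he, hx e he]
      have hS' : linearCombination F v (filter (· ∈ (A₁ : Set E)) (x - y)) = 0 := hS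
      rw [this] at hS'
      exact hS'
    · change linearCombination F v (filter (· ∈ (A₁ : Set E)) z) = 0
      rcases h z hz with h0 | h0
      · rw [(filter_eq_zero_iff (· ∈ (A₁ : Set E)) z).2 h0, map_zero]
      · rw [(filter_eq_self_iff (· ∈ (A₁ : Set E)) z).2 fun e he => by_contra fun h' => he (h0 e h')]
        exact (mem_relations.1 hz.1).1
  have := finrank_sup_add_finrank_inf_eq (span F (v '' A₁)) (span F (v '' A₂))
  rw [hbot, finrank_bot, add_zero] at this
  rw [← this]
  exact finrank_mono hle

/-- Contracting `c` means passing to the quotient by the span of its vectors. A relation `x` there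
lifts to a relation `x - u` with `u` supported on `c`. -/
theorem card_support_lt_of_isElementary_contract {W : Type*} [AddCommGroup W] [Module F W]
    [DecidableEq E] {v : E → W} {A : Finset E} {c : E →₀ F}
    (hc : IsElementary (relations F v A) c)
    (hmax : ∀ z, IsElementary (relations F v A) z → z.support.card ≤ c.support.card)
    (hconn : ∀ e f, c e ≠ 0 → f ∈ A → f ∉ c.support →
      ∃ z, IsElementary (relations F v A) z ∧ z e ≠ 0 ∧ z f ≠ 0) {x : E →₀ F}
    (hx : IsElementary (relations F
      (fun e => (span F (v '' c.support)).mkQ (v e)) (A \ c.support)) x) :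
    x.support.card < c.support.card := by
  set U := span F (v '' c.support)
  have hlc : ∀ u : E →₀ F,
      linearCombination F (fun e => U.mkQ (v e)) u = U.mkQ (linearCombination F v u) := fun u => by
    rw [apply_linearCombination]; rfl
  have hxr := mem_relations.1 hx.1
  have hxc : ∀ e, c e ≠ 0 → x e = 0 := fun e he => hxr.2 e fun h =>
    (Finset.mem_sdiff.1 h).2 (Finsupp.mem_support_iff.2 he)
  have hcA : c.support ⊆ A := fun i hi => by_contra fun h =>
    Finsupp.mem_support_iff.1 hi ((mem_relations.1 hc.1).2 i h)
  have hxU : linearCombination F v x ∈ U := by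
    rw [← Quotient.mk_eq_zero, ← mkQ_apply, ← hlc]
    exact hxr.1
  obtain ⟨u, hu, hux⟩ := (mem_span_image_iff_linearCombination F).1 hxU
  rw [mem_supported'] at hu
  have hu0 : ∀ e, c e = 0 → u e = 0 := fun e he => hu e (by simpa using he)
  refine card_support_lt_of_contract (y := x - u) hc hmax hxc hx.2.1
    (mem_relations.2 ⟨by rw [map_sub, hux, sub_self], fun e he => ?_⟩)
    (fun e he => by simp [hu0 e he]) (fun w hw hwx => ?_) (fun e f he hf => ?_)
  · rw [Finsupp.sub_apply, hxr.2 e fun h => he (Finset.mem_sdiff.1 h).1,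
      hu e fun h => he (hcA h), sub_zero]
  · classical
    have hw' := mem_relations.1 hw
    have hfw : filter (fun e => c e = 0) w ∈
        relations F (fun e => U.mkQ (v e)) (A \ c.support) := by
      refine mem_relations.2 ⟨?_, fun e he => ?_⟩
      · rw [hlc, mkQ_apply, Quotient.mk_eq_zero]
        have hsum := filter_add_filter_not w (fun e => c e = 0)
        have hneg : linearCombination F v (filter (fun e => ¬ c e = 0) w) ∈ U :=
          (mem_span_image_iff_linearCombination F).2 ⟨_, (mem_supported' _ _).2
            fun e he => filter_apply_neg _ _ fun h => he (by simpa using h), rfl⟩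
        rw [← U.add_mem_iff_left hneg, ← map_add, hsum, hw'.1]
        exact U.zero_mem
      · by_cases hce : c e = 0
        · rw [filter_apply_pos (fun e => c e = 0) _ hce]
          exact hw'.2 e fun h => he (Finset.mem_sdiff.2 ⟨h, by simpa using hce⟩)
        · exact filter_apply_neg (fun e => c e = 0) _ hce
    obtain ⟨a, ha⟩ := hx.2.2 _ hfw fun e he => by
      by_cases hce : c e = 0
      · rw [filter_apply_pos (fun e => c e = 0) _ hce, hwx e hce he]
      · exact filter_apply_neg (fun e => c e = 0) _ hce
    refine ⟨a, fun e he => ?_⟩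
    rw [← filter_apply_pos (fun e => c e = 0) w he, ha]
    rfl
  · have hfA := Finset.mem_sdiff.1 (by_contra fun h => hf (hxr.2 f h) : f ∈ A \ c.support)
    exact hconn e f he hfA.1 hfA.2

/-- If all circuits among the vectors `v e`, `e ∈ A`, have at most `k` elements, then the nonzero
vectors among them are covered by few sets of small rank. -/
theorem exists_cover {W : Type*} [AddCommGroup W] [Module F W] (v : E → W) (A : Finset E) (k : ℕ)
    (hk : ∀ z, IsElementary (relations F v A) z → z.support.card ≤ k) :
    ∃ G : Finset (Finset E), G.card ≤ finrank F (span F (v '' A)) ∧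
      (∀ B ∈ G, B ⊆ A ∧ finrank F (span F (v '' B)) ≤ k ^ 2 + 1) ∧
      ∀ e ∈ A, v e ≠ 0 → ∃ B ∈ G, e ∈ B := by
  classical
  induction A using Finset.strongInduction generalizing W k with
  | H A ih =>
  by_cases hloops : ∀ e ∈ A, v e = 0
  · exact ⟨∅, by simp, by simp, fun e he h => absurd (hloops e he) h⟩
  push Not at hloops
  obtain ⟨e, heA, hve⟩ := hloops
  -- The connected component of `e`; `e` is added by hand because it may lie in no circuit.
  set A₁ := A.filter fun f => f = e ∨ ∃ z, IsElementary (relations F v A) z ∧ z e ≠ 0 ∧ z f ≠ 0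
    with hA₁
  have heA₁ : e ∈ A₁ := by simp [hA₁, heA]
  have hsub₁ : A₁ ⊆ A := Finset.filter_subset _ _
  have hmemA : ∀ {z}, IsElementary (relations F v A) z → ∀ {f}, z f ≠ 0 → f ∈ A := fun hz f hf =>
    by_contra fun h => hf ((mem_relations.1 hz.1).2 f h)
  by_cases hA : A₁ = A
  swap
  · have hss₁ : A₁ ⊂ A := Finset.ssubset_iff_subset_ne.2 ⟨hsub₁, hA⟩
    have hss₂ : A \ A₁ ⊂ A := Finset.sdiff_ssubset hsub₁ ⟨e, heA₁⟩
    have hel : ∀ {B : Finset E}, B ⊆ A → ∀ z, IsElementary (relations F v B) z →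
        z.support.card ≤ k := by
      intro B hB z hz
      have hzB := mem_relations.1 hz.1
      refine hk z ⟨mem_relations.2 ⟨hzB.1, fun f hf => hzB.2 f fun h => hf (hB h)⟩, hz.2.1,
        fun w hw hwz => hz.2.2 w (mem_relations.2 ⟨(mem_relations.1 hw).1, fun f hf => ?_⟩) hwz⟩
      exact hwz f (hzB.2 f hf)
    obtain ⟨G₁, hG₁, hB₁, hc₁⟩ := ih A₁ hss₁ v k (hel hsub₁)
    obtain ⟨G₂, hG₂, hB₂, hc₂⟩ := ih (A \ A₁) hss₂ v k (hel Finset.sdiff_subset)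
    refine ⟨G₁ ∪ G₂, ?_, ?_, ?_⟩
    · refine (Finset.card_union_le _ _).trans ((add_le_add hG₁ hG₂).trans
        (finrank_add_finrank_le_of_separation v hsub₁ Finset.sdiff_subset
          Finset.disjoint_sdiff fun z hz => ?_))
      by_contra! hcon
      obtain ⟨⟨f, hf, hzf⟩, g, hg, hzg⟩ := hcon
      refine hg (Finset.mem_filter.2 ⟨hmemA hz hzg, Or.inr ?_⟩)
      rcases (Finset.mem_filter.1 hf).2 with rfl | ⟨y, hy, hye, hyf⟩
      · exact ⟨z, hz, hzf, hzg⟩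
      · exact hy.exists_through hz hye hzg hyf hzf
    · intro B hB
      rcases Finset.mem_union.1 hB with hB | hB
      · exact ⟨(hB₁ B hB).1.trans hsub₁, (hB₁ B hB).2⟩
      · exact ⟨(hB₂ B hB).1.trans Finset.sdiff_subset, (hB₂ B hB).2⟩
    · intro f hf hvf
      by_cases hf₁ : f ∈ A₁
      · obtain ⟨B, hB, hfB⟩ := hc₁ f hf₁ hvf
        exact ⟨B, Finset.mem_union_left _ hB, hfB⟩
      · obtain ⟨B, hB, hfB⟩ := hc₂ f (Finset.mem_sdiff.2 ⟨hf, hf₁⟩) hvf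
        exact ⟨B, Finset.mem_union_right _ hB, hfB⟩
  have hcirc : ∀ f ∈ A, f ≠ e → ∃ z, IsElementary (relations F v A) z ∧ z e ≠ 0 ∧ z f ≠ 0 := by
    intro f hf hfe
    rw [← hA] at hf
    exact (Finset.mem_filter.1 hf).2.resolve_left hfe
  have hrank : 1 ≤ finrank F (span F (v '' A)) := by
    rw [← finrank_span_singleton (K := F) hve]
    exact finrank_mono (span_mono (by simpa using ⟨e, heA, rfl⟩))
  by_cases hsing : ∀ f ∈ A, f = e
  · refine ⟨{{e}}, by simpa using hrank, ?_, ?_⟩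
    · intro B hB
      rw [Finset.mem_singleton] at hB
      subst hB
      refine ⟨by simpa using heA, (finrank_span_image_le v _).trans (by simp)⟩
    · intro f hf _
      exact ⟨{e}, by simp, by simp [hsing f hf]⟩
  push Not at hsing
  obtain ⟨f, hfA, hfe⟩ := hsing
  obtain ⟨z₀, hz₀, hz₀e, hz₀f⟩ := hcirc f hfA hfe
  -- a circuit of maximal size
  obtain ⟨c, hc, hmax⟩ : ∃ c, IsElementary (relations F v A) c ∧
      ∀ z, IsElementary (relations F v A) z → z.support.card ≤ c.support.card := by
    have hfin : {n | ∃ z, IsElementary (relations F v A) z ∧ z.support.card = n}.Finite :=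
      (Set.finite_Iic k).subset (by rintro _ ⟨z, hz, rfl⟩; exact hk z hz)
    obtain ⟨n, ⟨c, hc, hcn⟩, hn⟩ := Set.exists_max_image _ id hfin ⟨_, z₀, hz₀, rfl⟩
    exact ⟨c, hc, fun z hz => (hn _ ⟨z, hz, rfl⟩).trans hcn.ge⟩
  have hcA : c.support ⊆ A := fun i hi => hmemA hc (Finsupp.mem_support_iff.1 hi)
  have hz₀2 : 2 ≤ z₀.support.card := by
    have : ({e, f} : Finset E) ⊆ z₀.support := by
      intro i hi
      rcases Finset.mem_insert.1 hi with rfl | hi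
      · simpa using hz₀e
      · rw [Finset.mem_singleton.1 hi]; simpa using hz₀f
    simpa [Finset.card_pair (Ne.symm hfe)] using Finset.card_le_card this
  have hc2 : 2 ≤ c.support.card := hz₀2.trans (hmax _ hz₀)
  have hck := hk c hc
  -- A zero vector in `c` would be a circuit by itself, against `2 ≤ c.support.card`. Hence
  -- contracting `c` lowers the rank.
  have hloop : ∀ i ∈ c.support, v i ≠ 0 := by
    intro i hi hvi
    obtain ⟨a, ha⟩ := hc.2.2 (single i 1) (mem_relations.2 ⟨by simp [hvi], fun j hj =>
      single_eq_of_ne fun h => hj (h ▸ hcA hi)⟩) fun j hj =>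
      single_eq_of_ne fun h => Finsupp.mem_support_iff.1 hi (h ▸ hj)
    have ha0 : a ≠ 0 := by
      rintro rfl
      simp at ha
    have hcard : (single i (1 : F)).support.card = c.support.card := by
      rw [ha, support_smul_eq ha0]
    have := Finset.card_le_card (support_single_subset (a := i) (b := (1 : F)))
    rw [Finset.card_singleton] at this
    omega
  have hthrough : ∀ i j, c i ≠ 0 → j ∈ A → j ∉ c.support →
      ∃ z, IsElementary (relations F v A) z ∧ z i ≠ 0 ∧ z j ≠ 0 := by
    intro i j hi hj hjc
    by_cases hje : j = e
    · subst hje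
      by_cases hie : i = j
      · exact absurd (Finsupp.mem_support_iff.2 hi) (hie ▸ hjc)
      · obtain ⟨z, hz, h1, h2⟩ := hcirc i (hmemA hc hi) hie
        exact ⟨z, hz, h2, h1⟩
    · obtain ⟨z, hz, hze, hzj⟩ := hcirc j hj hje
      by_cases hie : i = e
      · exact ⟨z, hz, hie ▸ hze, hzj⟩
      · obtain ⟨y, hy, hye, hyi⟩ := hcirc i (hmemA hc hi) hie
        exact hy.exists_through hz hyi hzj hye hze
  obtain ⟨G, hG, hGB, hGc⟩ := ih (A \ c.support)
    (Finset.sdiff_ssubset hcA (Finset.card_pos.1 (by omega)))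
    (fun i => (span F (v '' c.support)).mkQ (v i)) (c.support.card - 1)
    (fun x hx => Nat.le_sub_one_of_lt
      (card_support_lt_of_isElementary_contract hc hmax hthrough hx))
  -- `G` need not cover the loops of the contraction. They lie in the span of `c`, so adding them to
  -- `c` does not raise its rank.
  set L := A.filter fun i => (span F (v '' c.support)).mkQ (v i) = 0
  have hcrank : 1 ≤ finrank F (span F (v '' c.support)) := by
    obtain ⟨i, hi⟩ := Finset.card_pos.1 (by omega : 0 < c.support.card)
    rw [← finrank_span_singleton (K := F) (hloop i hi)]
    exact finrank_mono (span_mono (by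
      rw [Set.singleton_subset_iff]; exact ⟨i, hi, rfl⟩))
  refine ⟨insert (c.support ∪ L) G, ?_, ?_, ?_⟩
  · have := finrank_contract_add_le (F := F) v hcA (Finset.sdiff_subset (s := A) (t := c.support))
    have := Finset.card_insert_le (c.support ∪ L) G
    omega
  · intro B hB
    have hb := finrank_span_image_le_contract (F := F) v c.support B
    rcases Finset.mem_insert.1 hB with rfl | hB
    · refine ⟨Finset.union_subset hcA (Finset.filter_subset _ _), ?_⟩
      have h0 : span F ((fun i => (span F (v '' c.support)).mkQ (v i)) '' ↑(c.support ∪ L)) = ⊥ := by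
        rw [span_eq_bot]
        rintro _ ⟨i, hi, rfl⟩
        rcases Finset.mem_union.1 hi with hi | hi
        · exact (Quotient.mk_eq_zero _).2 (subset_span ⟨i, hi, rfl⟩)
        · exact (Finset.mem_filter.1 hi).2
      rw [h0, finrank_bot, zero_add] at hb
      nlinarith
    · refine ⟨(hGB B hB).1.trans Finset.sdiff_subset, hb.trans ?_⟩
      have h1 := (hGB B hB).2
      -- The recursion closes because `(m ^ 2 + 1) + (m + 1) ≤ (m + 1) ^ 2 + 1`.
      obtain ⟨m, hm⟩ : ∃ m, c.support.card = m + 1 := ⟨c.support.card - 1, by omega⟩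
      rw [hm] at h1 hck ⊢
      rw [Nat.add_sub_cancel] at h1
      nlinarith
  · intro i hi hvi
    by_cases hiL : i ∈ c.support ∪ L
    · exact ⟨_, Finset.mem_insert_self _ _, hiL⟩
    · rw [Finset.mem_union, not_or] at hiL
      obtain ⟨B, hB, hiB⟩ := hGc i (Finset.mem_sdiff.2 ⟨hi, hiL.1⟩)
        fun h => hiL.2 (Finset.mem_filter.2 ⟨hi, h⟩)
      exact ⟨B, Finset.mem_insert_of_mem hB, hiB⟩

end Cover
-- Kruskal–Katona with explicit constants.
section Shadow

open Finset
open scoped FinsetFamily Nat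

/-- A weak numerical form of the Kruskal–Katona theorem over `Fin N`. -/
theorem card_pow_le_shadow_fin {N d : ℕ} (A : Finset (Finset (Fin N)))
    (hA : (A : Set (Finset (Fin N))).Sized (d + 1)) (hne : A.Nonempty) :
    A.card ^ d ≤ ((d + 1) ^ d * d !) ^ (d + 1) * (∂ A).card ^ (d + 1) := by
  obtain ⟨σ, hσ⟩ := hne
  have hdN : d + 1 ≤ N := by
    rw [← hA hσ]
    simpa using card_le_univ σ
  -- Up to the cap `N`, `n.choose (d + 1) ≤ A.card < (n + 1).choose (d + 1)`. The left side bounds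
  -- the shadow below, the right side bounds `A` by a power of `n + 1`.
  set n := Nat.findGreatest (fun n => n.choose (d + 1) ≤ A.card) N with hn
  have hone : (d + 1).choose (d + 1) ≤ A.card := by
    rw [Nat.choose_self]; exact card_pos.2 ⟨σ, hσ⟩
  have hdn : d + 1 ≤ n := Nat.le_findGreatest hdN hone
  have hnN : n ≤ N := Nat.findGreatest_le N
  have hnA : n.choose (d + 1) ≤ A.card :=
    Nat.findGreatest_spec (P := fun n => n.choose (d + 1) ≤ A.card) hdN hone
  have hshadow : n.choose d ≤ (∂ A).card := by
    simpa using kruskal_katona_lovasz_form (i := 1) (by omega) hdn hnN hA hnA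
  have hAn : A.card ≤ (n + 1) ^ (d + 1) := by
    refine le_trans ?_ (Nat.choose_le_pow (n + 1) (d + 1))
    rcases hnN.eq_or_lt with h | h
    · refine (hA.card_le).trans ?_
      rw [Fintype.card_fin, ← h]
      exact Nat.choose_le_choose _ (Nat.le_succ n)
    · exact (not_le.1 (Nat.findGreatest_is_greatest (P := fun n => n.choose (d + 1) ≤ A.card)
        (Nat.lt_succ_self n) h)).le
  have hpow : (n + 1 - d) ^ d ≤ d ! * (∂ A).card := by
    refine (Nat.pow_sub_le_descFactorial n d).trans ?_
    rw [Nat.descFactorial_eq_factorial_mul_choose]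
    exact Nat.mul_le_mul_left _ hshadow
  obtain ⟨m, hm⟩ : ∃ m, n + 1 = m + 1 + d := ⟨n - d, by omega⟩
  have hm' : n + 1 - d = m + 1 := by omega
  rw [hm'] at hpow
  have hbase : n + 1 ≤ (d + 1) * (m + 1) := by rw [hm]; nlinarith
  calc A.card ^ d ≤ (((d + 1) * (m + 1)) ^ (d + 1)) ^ d := by gcongr; exact hAn.trans (by gcongr)
    _ = ((d + 1) ^ d * (m + 1) ^ d) ^ (d + 1) := by
      rw [← mul_pow, ← pow_mul, ← pow_mul, mul_comm (d + 1) d]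
    _ ≤ ((d + 1) ^ d * (d ! * (∂ A).card)) ^ (d + 1) := by gcongr
    _ = _ := by rw [← mul_pow, mul_assoc]

/-- Only the finitely many vertices in use matter, so they are relabelled by `Fin`. For `d = 0` the
empty family would fail, as `0 ^ 0 = 1`. -/
theorem card_pow_le_shadow {V : Type*} [DecidableEq V] {d : ℕ} (hd : d ≠ 0)
    (A : Finset (Finset V)) (hA : ∀ σ ∈ A, σ.card = d + 1) :
    A.card ^ d ≤ ((d + 1) ^ d * d !) ^ (d + 1) * (∂ A).card ^ (d + 1) := by
  rcases A.eq_empty_or_nonempty with rfl | hne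
  · simp [hd]
  set U := A.biUnion id with hU
  let g : Fin U.card → V := fun i => (U.equivFin.symm i : V)
  have hg : Function.Injective g := Subtype.val_injective.comp U.equivFin.symm.injective
  let f : Finset V → Finset (Fin U.card) := fun σ => univ.filter fun i => g i ∈ σ
  have hfg : ∀ σ ∈ A, (f σ).image g = σ := by
    intro σ hσ
    ext a
    simp only [f, mem_image, mem_filter, mem_univ, true_and]
    refine ⟨fun ⟨i, hi, h⟩ => h ▸ hi, fun ha => ?_⟩
    have haU : a ∈ U := mem_biUnion.2 ⟨σ, hσ, ha⟩
    have : g (U.equivFin ⟨a, haU⟩) = a := by simp [g]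
    exact ⟨_, by rwa [this], this⟩
  have hinj : Set.InjOn f A := fun σ hσ τ hτ h => by rw [← hfg σ hσ, ← hfg τ hτ, h]
  have hsized : ((A.image f : Finset _) : Set (Finset (Fin U.card))).Sized (d + 1) := by
    intro τ hτ
    obtain ⟨σ, hσ, rfl⟩ := mem_image.1 (mem_coe.1 hτ)
    rw [← hA σ hσ]
    conv_rhs => rw [← hfg σ hσ]
    rw [card_image_of_injective _ hg]
  have hsh : ∂ (A.image f) ⊆ (∂ A).image f := by
    intro τ hτ
    obtain ⟨_, hs, i, hi, rfl⟩ := mem_shadow_iff.1 hτ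
    obtain ⟨σ, hσ, rfl⟩ := mem_image.1 hs
    refine mem_image.2 ⟨σ.erase (g i), erase_mem_shadow hσ (by simpa [f] using hi), ?_⟩
    ext j
    simp [f, hg.eq_iff]
  have := card_pow_le_shadow_fin (A.image f) hsized (hne.image f)
  rw [card_image_of_injOn hinj] at this
  refine this.trans ?_
  gcongr
  exact (card_le_card hsh).trans card_image_le

end Shadow

/-! ### Boundaries, shadows and simple cycles. -/

section Boundary

open Finset
open scoped FinsetFamily Nat

variable {F : Type*} [Field F] {V : Type*} [LinearOrder V]

theorem simplexBoundary_erase_ne_zero {σ : Finset V} {a : V} (ha : a ∈ σ) :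
    simplexBoundary F σ (σ.erase a) ≠ 0 := by
  rw [simplexBoundary, Finsupp.finsetSum_apply, sum_eq_single_of_mem a ha]
  · simp
  · intro b hb hba
    apply Finsupp.single_eq_of_ne
    intro h
    have : b ∈ σ.erase b := h ▸ mem_erase.2 ⟨hba, hb⟩
    exact (mem_erase.1 this).1 rfl

theorem exists_erase_eq_of_simplexBoundary_ne_zero {σ τ : Finset V}
    (h : simplexBoundary F σ τ ≠ 0) : ∃ a ∈ σ, σ.erase a = τ := by
  by_contra! hcon
  apply h
  rw [simplexBoundary, Finsupp.finsetSum_apply]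
  exact sum_eq_zero fun a ha => Finsupp.single_eq_of_ne (hcon a ha).symm

/-- A family of `d`-simplices and a basis of it have the same shadow. -/
theorem card_shadow_le_familyRank {d : ℕ} (A : Finset (Finset V))
    (hA : ∀ σ ∈ A, σ.card = d + 1) :
    (∂ A).card ≤ familyRank F (A : Set (Finset V)) * (d + 1) := by
  obtain ⟨B, hBA, -, hspan, hB⟩ := exists_linearIndepOn_extension
    (linearIndepOn_empty F (simplexBoundary F)) (Set.empty_subset (A : Set (Finset V)))
  obtain ⟨T, rfl⟩ := (A.finite_toSet.subset hBA).exists_finset_coe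
  have hrank : T.card ≤ familyRank F (A : Set (Finset V)) := by
    have := finrank_span_eq_card (LinearIndepOn.linearIndependent hB)
    rw [← Set.image_eq_range] at this
    rw [familyRank, ← Fintype.card_coe T]
    refine this.symm.le.trans ?_
    have : FiniteDimensional F (Submodule.span F (simplexBoundary F '' (A : Set (Finset V)))) :=
      finiteDimensional_span_image _ A
    exact Submodule.finrank_mono (Submodule.span_mono (Set.image_mono hBA))
  have hsub : ∂ A ⊆ ∂ T := by
    intro τ hτ
    obtain ⟨σ, hσ, a, ha, rfl⟩ := mem_shadow_iff.1 hτ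
    have hmem := hspan ⟨σ, hσ, rfl⟩
    by_contra hcon
    -- If no simplex of `T` has the facet `σ.erase a`, that coordinate vanishes on the span of their
    -- boundaries, which contains the boundary of `σ`.
    have hle : Submodule.span F (simplexBoundary F '' (T : Set (Finset V))) ≤
        LinearMap.ker (Finsupp.lapply (R := F) (M := F) (σ.erase a)) := by
      rw [Submodule.span_le]
      rintro _ ⟨t, ht, rfl⟩
      by_contra h
      obtain ⟨b, hb, hbt⟩ := exists_erase_eq_of_simplexBoundary_ne_zero (F := F) h
      exact hcon (hbt ▸ erase_mem_shadow ht hb)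
    exact simplexBoundary_erase_ne_zero (F := F) ha (hle hmem)
  refine (card_le_card hsub).trans (le_trans ?_ (Nat.mul_le_mul_right _ hrank))
  rw [shadow, sup_eq_biUnion]
  exact card_biUnion_le_card_mul _ _ _ fun σ hσ => card_image_le.trans (hA σ (hBA hσ)).le

/-- A dependency avoiding `σ` is a multiple of `x` that vanishes at `σ`, hence zero. -/
theorem isSimpleCycle_of_isElementary {K : PreAbstractSimplicialComplex V} {d : ℕ}
    {A : Finset (Finset V)} (hA : (A : Set (Finset V)) = simplices K d) {x : Finset V →₀ F}
    (hx : IsElementary (relations F (simplexBoundary F) A) x) : IsSimpleCycle F K d x := by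
  have hrel : relations F (simplexBoundary F) A = cycles F K d := by
    rw [relations, cycles, chains, boundary, hA, inf_comm]
  refine ⟨hrel ▸ hx.1, hx.2.1, fun σ hσ => linearIndepOn_iff.2 fun w hw hw0 => ?_⟩
  rw [Finsupp.mem_supported'] at hw
  have hwx : ∀ τ, x τ = 0 → w τ = 0 := fun τ h => hw τ fun hτ => by
    simpa [h] using hτ.1
  obtain ⟨a, rfl⟩ := hx.2.2 w (mem_relations.2 ⟨hw0, fun τ hτ =>
    hwx τ ((mem_relations.1 hx.1).2 τ hτ)⟩) hwx
  have h := hw σ (by simp)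
  rw [Finsupp.smul_apply, smul_eq_mul] at h
  rw [(mul_eq_zero.1 h).resolve_right (Finsupp.mem_support_iff.1 hσ), zero_smul]

end Boundary

end SimplicialCycle

theorem mainTheorem5 (d : ℕ) (hd : 1 ≤ d) :
    ∃ b : ℝ, 0 < b ∧
      ∀ (F : Type*) [Field F] (V : Type*) [LinearOrder V] (K : PreAbstractSimplicialComplex V),
        K.faces.Finite →
        SimplicialCycle.HasDimension K d →
        (∃ C ∈ SimplicialCycle.cycles F K d, C ≠ 0) →
        ∀ k : ℕ,
          b * (k : ℝ) ^ (2 + 2 / (d : ℝ)) * (SimplicialCycle.complexRank F K d : ℝ)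
              < (SimplicialCycle.faceCount K d : ℝ) →
          ∃ C : Finset V →₀ F,
            SimplicialCycle.IsSimpleCycle F K d C ∧ k < C.support.card := by
  open SimplicialCycle Finset FinsetFamily Nat in
  -- The Kruskal–Katona constant times the factor from a shadow of size at most `2 * (d + 1) * k ^
  -- 2`.
  set b : ℕ := ((d + 1) ^ d * d !) ^ (d + 1) * (2 * (d + 1)) ^ (d + 1) with hb
  have hb0 : 1 ≤ b := Nat.succ_le_of_lt (by positivity)
  refine ⟨b, by exact_mod_cast hb0, ?_⟩
  intro F _ V _ K hK _ hcyc k hk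
  by_contra! hcon
  have hfin : (simplices K d).Finite := hK.subset fun σ hσ => hσ.1
  obtain ⟨A, hA⟩ := hfin.exists_finset_coe
  have hAcard : ∀ σ ∈ A, σ.card = d + 1 := fun σ hσ => by
    have : σ ∈ simplices K d := hA ▸ hσ
    exact this.2
  obtain ⟨C, hC, hC0⟩ := hcyc
  obtain ⟨σ, hσ⟩ := Finsupp.ne_iff.1 hC0
  have hCr : C ∈ relations F (simplexBoundary F) A := by
    rw [relations, hA, inf_comm]; exact hC
  obtain ⟨z, hz, -, hzσ⟩ := exists_isElementary hCr hσ
  -- The given cycle contains a circuit, so `k = 0` is impossible; this allows `k ^ 2 + 1 ≤ 2 * k ^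
  -- 2`.
  have hk1 : 1 ≤ k := le_trans (card_pos.2 ⟨σ, Finsupp.mem_support_iff.2 hzσ⟩)
    (hcon z (isSimpleCycle_of_isElementary hA hz))
  obtain ⟨G, hG, hGB, hGc⟩ := exists_cover (simplexBoundary F) A k
    fun z hz => hcon z (isSimpleCycle_of_isElementary hA hz)
  have hsize : ∀ B ∈ G, (B.card : ℝ) ≤ b * (k : ℝ) ^ (2 + 2 / (d : ℝ)) := by
    intro B hB
    obtain ⟨hBA, hBr⟩ := hGB B hB
    have hBcard : ∀ σ ∈ B, σ.card = d + 1 := fun σ hσ => hAcard σ (hBA hσ)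
    have h1 := card_pow_le_shadow (by omega) B hBcard
    have h2 : (∂ B).card ≤ 2 * (d + 1) * k ^ 2 := by
      refine (card_shadow_le_familyRank (F := F) B hBcard).trans ?_
      have : familyRank F (B : Set (Finset V)) ≤ 2 * k ^ 2 := hBr.trans (by nlinarith)
      calc _ ≤ 2 * k ^ 2 * (d + 1) := Nat.mul_le_mul_right _ this
        _ = _ := by ring
    have h3 : B.card ^ d ≤ b ^ d * k ^ (2 * (d + 1)) := by
      calc B.card ^ d ≤ _ := h1
        _ ≤ ((d + 1) ^ d * d !) ^ (d + 1) * (2 * (d + 1) * k ^ 2) ^ (d + 1) := by gcongr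
        _ = b * k ^ (2 * (d + 1)) := by
          rw [hb, mul_pow (2 * (d + 1)), ← pow_mul, mul_assoc]
        _ ≤ b ^ d * k ^ (2 * (d + 1)) := by gcongr; exact Nat.le_self_pow (by omega) b
    have h4 : ((k : ℝ) ^ (2 + 2 / (d : ℝ))) ^ d = (k : ℝ) ^ (2 * (d + 1)) := by
      have hd0 : (d : ℝ) ≠ 0 := by positivity
      rw [← Real.rpow_mul_natCast (by positivity), ← Real.rpow_natCast]
      congr 1
      push_cast
      field_simp
    refine le_of_pow_le_pow_left₀ (by omega : d ≠ 0) (by positivity) ?_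
    rw [mul_pow, h4]
    exact_mod_cast h3
  have hcover : A.card ≤ ∑ B ∈ G, B.card := by
    refine le_trans (card_le_card fun σ hσ => ?_) (card_biUnion_le (s := G) (t := id))
    obtain ⟨a, ha⟩ := card_pos.1 (by rw [hAcard σ hσ]; omega : 0 < σ.card)
    obtain ⟨B, hB, hσB⟩ := hGc σ hσ fun h =>
      simplexBoundary_erase_ne_zero (F := F) ha (by rw [h]; rfl)
    exact mem_biUnion.2 ⟨B, hB, hσB⟩
  have hfc : faceCount K d = A.card := by rw [faceCount, ← hA, Set.ncard_coe_finset]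
  have hrk : G.card ≤ complexRank F K d := by
    rw [complexRank, familyRank, ← hA]; exact hG
  rw [hfc] at hk
  apply hk.not_ge
  calc (A.card : ℝ) ≤ ∑ B ∈ G, (B.card : ℝ) := by exact_mod_cast hcover
    _ ≤ ∑ B ∈ G, b * (k : ℝ) ^ (2 + 2 / (d : ℝ)) := sum_le_sum hsize
    _ = b * (k : ℝ) ^ (2 + 2 / (d : ℝ)) * G.card := by rw [sum_const, nsmul_eq_mul, mul_comm]
    _ ≤ _ := by gcongr
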